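/- Let $F$ be a finitary set functor with $F\emptyset\neq\emptyset$. Let $(\mu F,\varphi)$ be its initial algebra, $(\nu F,\tau)$ its terminal coalgebra, and $m\colon \mu F\to\nu F$ the unique coalgebra homomorphism from $(\mu F,\varphi^{-1})$ to $(\nu F,\tau)$. Fix a presentation of $F$, that is, a finitary signature $\Sigma$ and a natural transformation $\varepsilon\colon H_\Sigma\to F$ with surjective components, where $H_\Sigma X=\coprod_{n\in\mathbb N}\Sigma_n\times X^n$, and choose a nullary symbol $p\in\Sigma_0$. For a (possibly infinite) $\Sigma$-tree $s$ let $\partial_n s$ be the finite $\Sigma$-tree obtained by cutting away all nodes of height greater than $n$ and relabelling all nodes of height $n$ by $p$. Let $\sim$ be the congruence on finite $\Sigma$-trees generated by all substitution instances of $\varepsilon$-equations, i.e. of equations $\sigma(x_1,\dots,x_n)=\rho(y_1,\dots,y_k)$ between flat terms over a set $X$ of variables whose two sides are merged by $\varepsilon_X$. The set of all $\Sigma$-trees is an $F$-coalgebra (tree-tupling followed by $\varepsilon$); let $s\mapsto[s]$ be its unique coalgebra homomorphism into $\nu F$. Order $\nu F$ by cutting: $x\le y$ iff $x=y$, or there are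 a finite tree $s$, a tree $s'$ and $n\in\mathbb N$ with $x=[s]$, $y=[s']$ and $s\sim\partial_n s'$. Then $\nu F$ is a poset, and $m$ is injective, so that $\mu F$ is a subposet of $\nu F$ via $m$; for every set $X$ we order $(\mu F)^X$ and $(\nu F)^X$ pointwise. For every coalgebra $\alpha\colon X\to FX$ the poset $(\mu F)^X$ has a least element $h_0$, and with the approximate homomorphisms $h_{n+1}=\varphi\cdot Fh_n\cdot\alpha\colon X\to\mu F$ $(n\in\mathbb N)$, the maps $m\cdot h_n$ form an $\omega$-chain $m\cdot h_0\le m\cdot h_1\le\cdots$ in $(\nu F)^X$ whose join in $(\nu F)^X$ is the unique coalgebra homomorphism $h\colon(X,\alpha)\to(\nu F,\tau)$: $$h=\bigsqcup_{n\in\mathbb N} m\cdot h_n .$$ -/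

import Mathlib

open CategoryTheory

universe u

namespace Cutting

/-- A finitary signature: a set `S n` of `n`-ary operation symbols for every `n`. -/
abbrev Signature : Type (u + 1) := ℕ → Type u

/-- The polynomial functor `H_S X = ∐ n, S n × X ^ n`; the element `⟨n, σ, x⟩` is the
flat term `σ(x₁, …, xₙ)`. -/
def polyFunctor (S : Signature.{u}) : Type u ⥤ Type u where
  obj X := Σ n : ℕ, S n × (Fin n → X)
  map f := TypeCat.ofHom fun t => ⟨t.1, t.2.1, fun i => f (t.2.2 i)⟩
  map_id _ := rfl
  map_comp _ _ := rfl

/-- A presentation of a set functor `F`: a finitary signature `S` and a natural transformation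
`H_S ⟶ F` with epic components. -/
structure Presentation (F : Type u ⥤ Type u) where
  /-- the signature -/
  S : Signature.{u}
  /-- the natural transformation -/
  ε : polyFunctor S ⟶ F
  /-- its components are epic -/
  epi : ∀ X : Type u, Epi (ε.app X)

/-- Finite `S`-trees, the elements of the initial algebra of `H_S`. -/
inductive FinTree (S : Signature.{u}) : Type u
  | node {n : ℕ} (σ : S n) (t : Fin n → FinTree S) : FinTree S

/-- Shapes of nodes: an `n`-ary symbol has `n` successors. -/
def nodeShapes (S : Signature.{u}) : PFunctor.{u, 0} where
  A := Σ n : ℕ, S n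
  B a := Fin a.1

/-- All (possibly infinite) `S`-trees, the elements of the terminal coalgebra of `H_S`. -/
abbrev Tree (S : Signature.{u}) : Type u := (nodeShapes S).M

/-- Tree tupling: a tree is sent to its root symbol and its maximal proper subtrees. -/
def Tree.untuple {S : Signature.{u}} (t : Tree S) : (polyFunctor S).obj (Tree S) :=
  ⟨t.dest.1.1, t.dest.1.2, t.dest.2⟩

/-- The inclusion of finite trees into all trees. -/
def FinTree.toTree {S : Signature.{u}} : FinTree S → Tree S
  | .node (n := n) σ t => PFunctor.M.mk ⟨⟨n, σ⟩, fun i => (t i).toTree⟩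

/-- The cutting `∂ n s`: all nodes of height larger than `n` are cut away and all nodes of
height `n` are relabelled by the nullary symbol `p`. -/
def cut {S : Signature.{u}} (p : S 0) : ℕ → Tree S → FinTree S
  | 0, _ => .node p Fin.elim0
  | n + 1, s => .node s.dest.1.2 fun i => cut p n (s.dest.2 i)

section

variable {F : Type u ⥤ Type u}

/-- The congruence `∼` on finite trees: `s ∼ t` iff `t` is obtained from `s` by a finite
application of `ε`-equations `σ(x₁, …, xₙ) = ρ(y₁, …, yₘ)`, i.e. pairs of flat terms over a set
`X` of variables which are merged by `ε`. -/
inductive FinCongr (P : Presentation F) : FinTree P.S → FinTree P.S → Prop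
  | refl (s : FinTree P.S) : FinCongr P s s
  | symm {s t : FinTree P.S} : FinCongr P s t → FinCongr P t s
  | trans {s t r : FinTree P.S} : FinCongr P s t → FinCongr P t r → FinCongr P s r
  | congr {n : ℕ} (σ : P.S n) (s t : Fin n → FinTree P.S) :
      (∀ i, FinCongr P (s i) (t i)) → FinCongr P (.node σ s) (.node σ t)
  | equation {X : Type u} {n m : ℕ} (σ : P.S n) (x : Fin n → X) (ρ : P.S m) (y : Fin m → X)
      (h : P.ε.app X (⟨n, σ, x⟩ : Σ n : ℕ, P.S n × (Fin n → X)) =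
        P.ε.app X (⟨m, ρ, y⟩ : Σ n : ℕ, P.S n × (Fin n → X)))
      (f : X → FinTree P.S) :
      FinCongr P (.node σ fun i => f (x i)) (.node ρ fun j => f (y j))

/-- The coalgebra of all trees, considered as a coalgebra for `F`. -/
def treeCoalgebra (P : Presentation F) : Endofunctor.Coalgebra F where
  V := Tree P.S
  str := TypeCat.ofHom fun t => P.ε.app (Tree P.S) t.untuple

/-- The canonical map from trees to the terminal coalgebra `νF`, i.e. the unique coalgebra
homomorphism; it exhibits `νF` as the quotient of the coalgebra of trees, and `treeClass P hν s`
is the element of `νF` represented by the tree `s`. -/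
def treeClass (P : Presentation F) {νF : Endofunctor.Coalgebra F} (hν : Limits.IsTerminal νF)
    (s : Tree P.S) : νF.V :=
  (hν.from (treeCoalgebra P)).f s

/-- The order by cutting on `νF`: for distinct `x = [s]` and `y = [s']` we have `x < y` iff
`s ∼ ∂ n s'` for some `n`. -/
def CutLE (P : Presentation F) (p : P.S 0) {νF : Endofunctor.Coalgebra F}
    (hν : Limits.IsTerminal νF) (x y : νF.V) : Prop :=
  x = y ∨ ∃ (s : FinTree P.S) (s' : Tree P.S) (n : ℕ),
    treeClass P hν s.toTree = x ∧ treeClass P hν s' = y ∧ FinCongr P s (cut p n s')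

/-- The initial algebra `(μF, φ)` considered as the coalgebra `(μF, φ⁻¹)`. -/
def initialCoalgebra {μF : Endofunctor.Algebra F} (hμ : Limits.IsInitial μF) :
    Endofunctor.Coalgebra F where
  V := μF.a
  str := Endofunctor.Algebra.Initial.strInv hμ

/-- The map `m : μF → νF`, the unique coalgebra homomorphism from `(μF, φ⁻¹)`. -/
def incl {μF : Endofunctor.Algebra F} (hμ : Limits.IsInitial μF)
    {νF : Endofunctor.Coalgebra F} (hν : Limits.IsTerminal νF) (z : μF.a) : νF.V :=
  (hν.from (initialCoalgebra hμ)).f z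

/-- `h` is the sequence of approximate homomorphisms of the coalgebra `A`: `h 0` is the least
element of `(μF) ^ X`, which is ordered pointwise, `μF` being ordered as a subset of `νF` along
`m`; and `h (n + 1) = φ · F (h n) · α`. -/
structure IsApproxHom {μF : Endofunctor.Algebra F}
    (hμ : Limits.IsInitial μF) {νF : Endofunctor.Coalgebra F} [PartialOrder νF.V]
    (hν : Limits.IsTerminal νF) (A : Endofunctor.Coalgebra F) (h : ℕ → A.V → μF.a) : Prop where
  /-- `h 0` is the least element -/
  least : ∀ g : A.V → μF.a, ∀ x, incl hμ hν (h 0 x) ≤ incl hμ hν (g x)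
  /-- the recursion -/
  step : ∀ n x, h (n + 1) x = μF.str (F.map (TypeCat.ofHom (h n)) (A.str x))

end

end Cutting

/-!
The recursion for approximate homomorphisms, started with the class of the single-node tree `p`,
makes sense for every coalgebra `A` and gives its truncations `trunc A n : A → μF`. They commute
with coalgebra homomorphisms (`trunc_hom`). Write `∂ n` for the truncations of `(μF, φ⁻¹)` and,
composed with `m`, for those of `νF`; then `∂ n ∘ trunc A k = trunc A (min n k)`
(`truncInit_trunc`), hence `∂ n ∘ ∂ k = ∂ (min n k)` on `νF` (`truncEnd_truncEnd`).

On the coalgebra of trees, the `n`-th truncation of `s` is the value in `μF` of the finite tree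
`cut p n s` (`eval_cut`), and `∼`-related finite trees have the same value (`FinCongr.eval_eq`).
Therefore `x ≤ y` in the order by cutting iff `x = y` or `x = ∂ n y` for some `n` (`cutLE_iff`),
and the laws of a partial order are consequences of `∂ n ∘ ∂ k = ∂ (min n k)`.

The two substantial facts are the following.
* Every element of `μF` is fixed by some truncation, as the elements with this property form a
  subalgebra (`exists_truncInit_eq_self`). Since `m` commutes with truncations, it is injective.
* Elements of `νF` with the same truncations are equal (`eq_of_trunc_eq`). By finitarity, in the
  form that elements of `F Q` are flat terms in finitely many elements of `Q`, identifying
  elements of `νF` with the same truncations gives a quotient coalgebra; terminality makes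
  the quotient map injective.

Finally, `m ∘ h_n = ∂ n ∘ h`, so only the following remains: if all
truncations of `y` lie below `u`, then `y ≤ u` (`cutLE_of_truncEnd_cutLE`). Each `∂ n y` equals
`∂ k u` for some `k`; fix one such `k` for every `n`. If these indices are unbounded, then `y` and
`u` have the same truncations, hence `y = u`. Otherwise `y` has only finitely many different
truncations and is itself one of them (`exists_eq_truncEnd_of_finite_range`), hence `y ≤ u`.
-/

namespace Cutting

/-! ### Presented functors -/

section Functor

variable {F : Type u ⥤ Type u}

/-- The action of a set functor on a function. -/
def mapF (F : Type u ⥤ Type u) {X Y : Type u} (f : X → Y) : F.obj X → F.obj Y :=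
  F.map (TypeCat.ofHom f)

theorem mapF_mapF {X Y Z : Type u} (f : X → Y) (g : Y → Z) (a : F.obj X) :
    mapF F g (mapF F f a) = mapF F (g ∘ f) a :=
  (F.map_comp_apply (TypeCat.ofHom f) (TypeCat.ofHom g) a).symm

/-- The element of `F X` presented by the flat term `σ(x₁, …, xₙ)`. -/
def flat (P : Presentation F) {X : Type u} {n : ℕ} (σ : P.S n) (x : Fin n → X) : F.obj X :=
  P.ε.app X (⟨n, σ, x⟩ : Σ n : ℕ, P.S n × (Fin n → X))

theorem mapF_flat (P : Presentation F) {X Y : Type u} (f : X → Y) {n : ℕ} (σ : P.S n)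
    (x : Fin n → X) : mapF F f (flat P σ x) = flat P σ (f ∘ x) :=
  (types_congr_hom (P.ε.naturality (TypeCat.ofHom f))
    (⟨n, σ, x⟩ : Σ n : ℕ, P.S n × (Fin n → X))).symm

theorem exists_flat (P : Presentation F) {X : Type u} (a : F.obj X) :
    ∃ (n : ℕ) (σ : P.S n) (x : Fin n → X), flat P σ x = a := by
  have := P.epi X
  obtain ⟨⟨n, σ, x⟩, h⟩ := surjective_of_epi (P.ε.app X) a
  exact ⟨n, σ, x, h⟩

/-- A presented functor preserves joint injectivity of a sequence of functions whose kernels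
decrease: two flat terms involve finitely many elements, on which a single function of the
sequence is injective. -/
theorem mapF_jointly_injective (P : Presentation F) {X Y : Type u} [Nonempty X] (g : ℕ → X → Y)
    (hg : ∀ n k, n ≤ k → ∀ x y, g k x = g k y → g n x = g n y)
    (hinj : ∀ x y, (∀ n, g n x = g n y) → x = y) {a b : F.obj X}
    (hab : ∀ n, mapF F (g n) a = mapF F (g n) b) : a = b := by
  classical
  obtain ⟨k, σ, x, rfl⟩ := exists_flat P a
  obtain ⟨l, ρ, y, rfl⟩ := exists_flat P b
  have hsep : ∀ q : X × X, ∃ n, g n q.1 = g n q.2 → q.1 = q.2 := by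
    intro q
    by_contra! h
    exact (h 0).2 (hinj _ _ fun n => (h n).1)
  choose N hN using hsep
  let Z : Finset X := Finset.univ.image x ∪ Finset.univ.image y
  let M : ℕ := (Z ×ˢ Z).sup N
  have hM : Set.InjOn (g M) (Z : Set X) := by
    intro c hc d hd h
    exact hN (c, d) (hg _ M (Finset.le_sup (f := N) (Finset.mk_mem_product hc hd)) _ _ h)
  have hr := hM.leftInvOn_invFunOn
  have h := congrArg (mapF F (Function.invFunOn (g M) (Z : Set X))) (hab M)
  rw [mapF_mapF, mapF_mapF, mapF_flat, mapF_flat] at h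
  have hx : (Function.invFunOn (g M) (Z : Set X) ∘ g M) ∘ x = x :=
    funext fun i => hr (by simp [Z])
  have hy : (Function.invFunOn (g M) (Z : Set X) ∘ g M) ∘ y = y :=
    funext fun i => hr (by simp [Z])
  rwa [hx, hy] at h

theorem coalgebra_hom_str {A B : Endofunctor.Coalgebra F} (f : A ⟶ B) (x : A.V) :
    B.str (f.f x) = mapF F (fun a => f.f a) (A.str x) :=
  (types_congr_hom f.h x).symm

theorem terminal_str_injective {νF : Endofunctor.Coalgebra F} (hν : Limits.IsTerminal νF) :
    Function.Injective νF.str := by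
  have := Endofunctor.Coalgebra.Terminal.str_isIso hν
  exact ((isIso_iff_bijective νF.str).1 this).1

end Functor

/-! ### Truncations -/

section Truncation

variable {F : Type u ⥤ Type u} (P : Presentation F) (p : P.S 0)
  {μF : Endofunctor.Algebra F} (hμ : Limits.IsInitial μF)
  {νF : Endofunctor.Coalgebra F} (hν : Limits.IsTerminal νF)

/-- The element of `μF` represented by the single-node tree `p`. -/
def bot (μF : Endofunctor.Algebra F) : μF.a :=
  μF.str (flat P p Fin.elim0)

/-- The approximate homomorphisms of a coalgebra `A`, for the sequence starting with the constant
function of value `bot`. For trees this is cutting followed by evaluation in `μF`. -/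
def trunc (μF : Endofunctor.Algebra F) (A : Endofunctor.Coalgebra F) : ℕ → A.V → μF.a
  | 0, _ => bot P p μF
  | n + 1, x => μF.str (mapF F (trunc μF A n) (A.str x))

theorem trunc_succ (A : Endofunctor.Coalgebra F) (n : ℕ) (x : A.V) :
    trunc P p μF A (n + 1) x = μF.str (mapF F (trunc P p μF A n) (A.str x)) :=
  rfl

theorem trunc_hom {A B : Endofunctor.Coalgebra F} (f : A ⟶ B) (n : ℕ) (x : A.V) :
    trunc P p μF B n (f.f x) = trunc P p μF A n x := by
  induction n generalizing x with
  | zero => rfl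
  | succ n ih =>
    rw [trunc_succ, coalgebra_hom_str, mapF_mapF, trunc_succ]
    exact congrArg (fun g => μF.str (mapF F g (A.str x))) (funext ih)

theorem initialCoalgebra_str (a : F.obj μF.a) : (initialCoalgebra hμ).str (μF.str a) = a :=
  types_congr_hom (Endofunctor.Algebra.Initial.right_inv hμ) a

theorem initial_str_injective (hμ : Limits.IsInitial μF) : Function.Injective μF.str :=
  Function.LeftInverse.injective (initialCoalgebra_str hμ)

/-- The truncation of the coalgebra `(μF, φ⁻¹)`, as a map from `μF` to itself. -/
def truncInit (n : ℕ) : μF.a → μF.a :=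
  trunc P p μF (initialCoalgebra hμ) n

theorem truncInit_succ_str (n : ℕ) (a : F.obj μF.a) :
    truncInit P p hμ (n + 1) (μF.str a) = μF.str (mapF F (truncInit P p hμ n) a) :=
  congrArg (fun b => μF.str (mapF F (truncInit P p hμ n) b)) (initialCoalgebra_str hμ a)

theorem truncInit_bot (n : ℕ) :
    truncInit P p hμ n (bot P p μF) = bot P p μF := by
  cases n with
  | zero => rfl
  | succ n =>
    rw [bot, truncInit_succ_str, mapF_flat]
    congr 2
    exact funext fun i => i.elim0

theorem truncInit_trunc (A : Endofunctor.Coalgebra F) (n k : ℕ) (x : A.V) :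
    truncInit P p hμ n (trunc P p μF A k x) = trunc P p μF A (min n k) x := by
  induction n generalizing k x with
  | zero => rw [Nat.zero_min]; rfl
  | succ n ih =>
    cases k with
    | zero => exact truncInit_bot P p hμ (n + 1)
    | succ k =>
      rw [Nat.succ_min_succ, trunc_succ, truncInit_succ_str, mapF_mapF, trunc_succ]
      exact congrArg (fun g => μF.str (mapF F g (A.str x))) (funext (ih k))

/-- A subset of the initial algebra closed under the operations named by flat terms is the whole
algebra. -/
theorem initial_induction (hμ : Limits.IsInitial μF) {I : Set μF.a}
    (hI : ∀ {n : ℕ} (σ : P.S n) (x : Fin n → μF.a), (∀ i, x i ∈ I) → μF.str (flat P σ x) ∈ I)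
    (z : μF.a) : z ∈ I := by
  have key : ∀ a : F.obj I, μF.str (mapF F Subtype.val a) ∈ I := by
    intro a
    obtain ⟨n, σ, x, rfl⟩ := exists_flat P a
    rw [mapF_flat]
    exact hI σ _ fun i => (x i).2
  let B : Endofunctor.Algebra F :=
    { a := I, str := TypeCat.ofHom fun a => ⟨μF.str (mapF F Subtype.val a), key a⟩ }
  let j : B ⟶ μF := { f := TypeCat.ofHom Subtype.val, h := rfl }
  have h : hμ.to B ≫ j = 𝟙 μF := hμ.hom_ext _ _
  have h' : ((hμ.to B).f z : I).1 = z := types_congr_hom (congrArg (fun f => f.f) h) z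
  rw [← h']
  exact Subtype.prop _

theorem truncInit_truncInit (n k : ℕ) (z : μF.a) :
    truncInit P p hμ n (truncInit P p hμ k z) = truncInit P p hμ (min n k) z :=
  truncInit_trunc P p hμ (initialCoalgebra hμ) n k z

theorem exists_truncInit_eq_self (z : μF.a) :
    ∃ n, truncInit P p hμ n z = z := by
  refine initial_induction P hμ
    (I := {z | ∃ n, truncInit P p hμ n z = z}) (fun {k} σ x hx => ?_) z
  choose N hN using hx
  refine ⟨Finset.univ.sup N + 1, ?_⟩
  rw [truncInit_succ_str, mapF_flat]
  congr 2
  funext i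
  have h := truncInit_truncInit P p hμ (Finset.univ.sup N) (N i) (x i)
  rwa [min_eq_right (Finset.le_sup (Finset.mem_univ i)), hN] at h

theorem trunc_incl (n : ℕ) (z : μF.a) :
    trunc P p μF νF n (incl hμ hν z) = truncInit P p hμ n z :=
  trunc_hom P p (hν.from (initialCoalgebra hμ)) n z

theorem incl_injective (P : Presentation F) (p : P.S 0) (hμ : Limits.IsInitial μF)
    (hν : Limits.IsTerminal νF) : Function.Injective (incl hμ hν) := by
  intro z w h
  obtain ⟨n, hn⟩ := exists_truncInit_eq_self P p hμ z
  obtain ⟨k, hk⟩ := exists_truncInit_eq_self P p hμ w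
  have h' : ∀ l, truncInit P p hμ l z = truncInit P p hμ l w := fun l => by
    rw [← trunc_incl P p hμ hν, h, trunc_incl]
  calc z = truncInit P p hμ n w := by rw [← h', hn]
    _ = truncInit P p hμ (min n k) w := by rw [← truncInit_truncInit, hk]
    _ = truncInit P p hμ (min k n) z := by rw [min_comm, h']
    _ = truncInit P p hμ k z := by rw [← truncInit_truncInit, hn]
    _ = w := by rw [h', hk]

/-- Elements of the terminal coalgebra with the same truncations are equal: having the same
truncations is the kernel of a coalgebra homomorphism `νF ⟶ B`, which has a retraction because
`νF` is terminal. -/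
theorem eq_of_trunc_eq (hμ : Limits.IsInitial μF) (hν : Limits.IsTerminal νF) {x y : νF.V}
    (h : ∀ n, trunc P p μF νF n x = trunc P p μF νF n y) : x = y := by
  let s : Setoid νF.V :=
    { r := fun x y => ∀ n, trunc P p μF νF n x = trunc P p μF νF n y
      iseqv := ⟨fun _ _ => rfl, fun h n => (h n).symm, fun h h' n => (h n).trans (h' n)⟩ }
  let g : ℕ → Quotient s → μF.a := fun n => Quotient.lift (trunc P p μF νF n) fun _ _ h => h n
  have hg : ∀ n k, n ≤ k → ∀ a b, g k a = g k b → g n a = g n b := by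
    rintro n k hnk ⟨a⟩ ⟨b⟩ hab
    have := congrArg (truncInit P p hμ n) hab
    change truncInit P p hμ n (trunc P p μF νF k a) =
      truncInit P p hμ n (trunc P p μF νF k b) at this
    rwa [truncInit_trunc, truncInit_trunc, min_eq_left hnk] at this
  have hinj : ∀ a b, (∀ n, g n a = g n b) → a = b := by
    rintro ⟨a⟩ ⟨b⟩ hab
    exact Quotient.sound hab
  have key : ∀ a b : νF.V, s.r a b →
      mapF F (Quotient.mk s) (νF.str a) = mapF F (Quotient.mk s) (νF.str b) := by
    intro a b hab
    have : Nonempty (Quotient s) := ⟨Quotient.mk s a⟩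
    refine mapF_jointly_injective P g hg hinj fun n => ?_
    rw [mapF_mapF, mapF_mapF]
    exact initial_str_injective hμ (hab (n + 1))
  let B : Endofunctor.Coalgebra F :=
    { V := Quotient s
      str := TypeCat.ofHom (Quotient.lift (fun a => mapF F (Quotient.mk s) (νF.str a)) key) }
  let q : νF ⟶ B := { f := TypeCat.ofHom (Quotient.mk s), h := rfl }
  have hq : q ≫ hν.from B = 𝟙 νF := hν.hom_ext _ _
  have hq' : ∀ a, (hν.from B).f (Quotient.mk s a) = a :=
    fun a => types_congr_hom (congrArg (fun f => f.f) hq) a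
  rw [← hq' x, ← hq' y]
  exact congrArg _ (Quotient.sound h)

theorem incl_str (a : F.obj μF.a) :
    νF.str (incl hμ hν (μF.str a)) = mapF F (incl hμ hν) a := by
  have h := coalgebra_hom_str (hν.from (initialCoalgebra hμ)) (μF.str a)
  rwa [initialCoalgebra_str hμ] at h

/-! ### Trees -/

/-- The value of a finite tree in the initial algebra. -/
def eval (μF : Endofunctor.Algebra F) : FinTree P.S → μF.a
  | .node σ t => μF.str (flat P σ fun i => eval μF (t i))

theorem FinCongr.eval_eq {s t : FinTree P.S} (h : FinCongr P s t) :
    eval P μF s = eval P μF t := by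
  induction h with
  | refl => rfl
  | symm _ ih => exact ih.symm
  | trans _ _ ih ih' => exact ih.trans ih'
  | congr σ s t _ ih => rw [eval, eval, funext ih]
  | equation σ x ρ y h f =>
    have h' := congrArg (mapF F fun z => eval P μF (f z)) (show flat P σ x = flat P ρ y from h)
    rw [mapF_flat, mapF_flat] at h'
    exact congrArg μF.str h'

theorem eval_cut (n : ℕ) (s : Tree P.S) :
    eval P μF (cut p n s) = trunc P p μF (treeCoalgebra P) n s := by
  induction n generalizing s with
  | zero =>
    rw [cut, eval]
    exact congrArg (fun x => μF.str (flat P p x)) (funext fun i => i.elim0)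
  | succ n ih =>
    refine congrArg μF.str (Eq.trans ?_
      (mapF_flat P (trunc P p μF (treeCoalgebra P) n) s.dest.1.2 s.dest.2).symm)
    exact congrArg (flat P s.dest.1.2) (funext fun i => ih (s.dest.2 i))

theorem treeClass_toTree (s : FinTree P.S) :
    treeClass P hν s.toTree = incl hμ hν (eval P μF s) := by
  induction s with
  | node σ t ih =>
    apply terminal_str_injective hν
    have h : (treeCoalgebra P).str (FinTree.node σ t).toTree =
        flat P σ fun i => (t i).toTree := rfl
    rw [eval, incl_str, mapF_flat]
    refine (coalgebra_hom_str (hν.from (treeCoalgebra P)) _).trans ?_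
    rw [h]
    exact (mapF_flat P _ _ _).trans (congrArg (flat P σ) (funext ih))

theorem trunc_treeClass (n : ℕ) (s : Tree P.S) :
    trunc P p μF νF n (treeClass P hν s) = eval P μF (cut p n s) := by
  rw [eval_cut]
  exact trunc_hom P p (hν.from (treeCoalgebra P)) n s

/-- Every element of `νF` is represented by a tree: choose for the elements of `F (νF)` flat
terms presenting them, and unfold. -/
theorem treeClass_surjective : Function.Surjective (treeClass P hν) := by
  choose n σ x hx using fun a : νF.V => exists_flat P (νF.str a)
  let c : νF.V → Tree P.S :=
    PFunctor.M.corec (F := nodeShapes P.S) fun a => ⟨⟨n a, σ a⟩, x a⟩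
  have hc : ∀ a, P.ε.app (Tree P.S) (c a).untuple = mapF F c (νF.str a) := by
    intro a
    rw [← hx a, mapF_flat]
    have h : (c a).dest = ⟨⟨n a, σ a⟩, c ∘ x a⟩ := PFunctor.M.dest_corec _ a
    exact congrArg (fun d : nodeShapes P.S (Tree P.S) => flat P d.1.2 d.2) h
  let f : νF ⟶ treeCoalgebra P :=
    { f := TypeCat.ofHom c
      h := by
        apply ConcreteCategory.hom_ext
        exact fun a => (hc a).symm }
  have h : f ≫ hν.from (treeCoalgebra P) = 𝟙 νF := hν.hom_ext _ _
  exact fun a => ⟨c a, types_congr_hom (congrArg (fun f => f.f) h) a⟩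

/-! ### The order by cutting -/

theorem cutLE_iff (x y : νF.V) :
    CutLE P p hν x y ↔ x = y ∨ ∃ n, x = incl hμ hν (trunc P p μF νF n y) := by
  refine or_congr_right ⟨?_, ?_⟩
  · rintro ⟨s, s', n, rfl, rfl, h⟩
    exact ⟨n, by rw [treeClass_toTree P hμ hν, trunc_treeClass, h.eval_eq]⟩
  · rintro ⟨n, rfl⟩
    obtain ⟨s', rfl⟩ := treeClass_surjective P hν y
    exact ⟨cut p n s', s', n, by rw [treeClass_toTree P hμ hν, trunc_treeClass], rfl, .refl _⟩

/-- The truncation of `νF`, as a map from `νF` to itself. -/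
def truncEnd (n : ℕ) (y : νF.V) : νF.V :=
  incl hμ hν (trunc P p μF νF n y)

theorem truncEnd_truncEnd (n k : ℕ) (y : νF.V) :
    truncEnd P p hμ hν n (truncEnd P p hμ hν k y) = truncEnd P p hμ hν (min n k) y := by
  rw [truncEnd, truncEnd, trunc_incl, truncInit_trunc, truncEnd]

theorem eq_of_truncEnd_eq {x y : νF.V}
    (h : ∀ n, truncEnd P p hμ hν n x = truncEnd P p hμ hν n y) : x = y :=
  eq_of_trunc_eq P p hμ hν fun n => incl_injective P p hμ hν (h n)

theorem truncEnd_eq_of_le {n k : ℕ} (hnk : n ≤ k) {x y : νF.V}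
    (h : truncEnd P p hμ hν k x = truncEnd P p hμ hν k y) :
    truncEnd P p hμ hν n x = truncEnd P p hμ hν n y := by
  have := congrArg (truncEnd P p hμ hν n) h
  rwa [truncEnd_truncEnd, truncEnd_truncEnd, min_eq_left hnk] at this

/-- The order by cutting on `νF`. -/
abbrev cutOrder : PartialOrder νF.V where
  le := CutLE P p hν
  le_refl x := Or.inl rfl
  le_trans x y z := by
    rw [cutLE_iff P p hμ, cutLE_iff P p hμ, cutLE_iff P p hμ]
    rintro (rfl | ⟨n, rfl⟩) (rfl | ⟨k, rfl⟩)
    · exact Or.inl rfl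
    · exact Or.inr ⟨k, rfl⟩
    · exact Or.inr ⟨n, rfl⟩
    · exact Or.inr ⟨min n k, truncEnd_truncEnd P p hμ hν n k z⟩
  le_antisymm x y := by
    rw [cutLE_iff P p hμ, cutLE_iff P p hμ]
    rintro (h | ⟨n, hx⟩) (h' | ⟨k, hy⟩)
    · exact h
    · exact h
    · exact h'.symm
    · change x = truncEnd P p hμ hν n y at hx
      change y = truncEnd P p hμ hν k x at hy
      have hx' := truncEnd_truncEnd P p hμ hν n k x
      have hy' := truncEnd_truncEnd P p hμ hν k n y
      rw [← hy, ← hx] at hx'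
      rw [← hx, ← hy] at hy'
      rcases le_total n k with hnk | hnk
      · rw [min_eq_right hnk, ← hx] at hy'
        exact hy'.symm
      · rw [min_eq_right hnk, ← hy] at hx'
        exact hx'

/-- An element of `νF` with finitely many truncations is one of them. -/
theorem exists_eq_truncEnd_of_finite_range {y : νF.V}
    (h : (Set.range fun n => truncEnd P p hμ hν n y).Finite) :
    ∃ n, y = truncEnd P p hμ hν n y := by
  -- By the pigeonhole principle some truncation occurs for arbitrarily large indices.
  obtain ⟨_, ⟨n, rfl⟩, hn⟩ : ∃ z ∈ Set.range (fun n => truncEnd P p hμ hν n y),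
      ∀ N, ∃ k ≥ N, truncEnd P p hμ hν k y = z := by
    by_contra! hcon
    choose! N hN using hcon
    let M := h.toFinset.sup N
    have hmem : truncEnd P p hμ hν M y ∈ Set.range (fun n => truncEnd P p hμ hν n y) := ⟨M, rfl⟩
    exact hN _ hmem M (Finset.le_sup (f := N) (h.mem_toFinset.2 hmem)) rfl
  refine ⟨n, eq_of_truncEnd_eq P p hμ hν fun l => ?_⟩
  obtain ⟨k, hk, hkn⟩ := hn l
  have h' := congrArg (truncEnd P p hμ hν l) hkn
  rwa [truncEnd_truncEnd, min_eq_left hk] at h'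

/-- An element of `νF` is below every upper bound of its truncations. The point is that
`∂ n y` is some `∂ k u` where `k` need not be `n`. -/
theorem cutLE_of_truncEnd_cutLE {y u : νF.V}
    (h : ∀ n, CutLE P p hν (truncEnd P p hμ hν n y) u) : CutLE P p hν y u := by
  have h' : ∀ n, ∃ k, truncEnd P p hμ hν n y = truncEnd P p hμ hν k u := by
    intro n
    rcases (cutLE_iff P p hμ hν _ _).1 (h n) with hn | hn
    · exact ⟨n, by rw [← hn, truncEnd_truncEnd, min_self]⟩
    · exact hn
  choose k hk using h'
  -- Applying the smaller of the two truncations to both sides makes the indices equal.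
  have hmin : ∀ n, truncEnd P p hμ hν (min n (k n)) y = truncEnd P p hμ hν (min n (k n)) u := by
    intro n
    have := congrArg (truncEnd P p hμ hν (min n (k n))) (hk n)
    rwa [truncEnd_truncEnd, truncEnd_truncEnd, min_eq_left (min_le_left _ _),
      min_eq_left (min_le_right _ _)] at this
  by_cases hb : ∃ K, ∀ n, k n ≤ K
  · obtain ⟨K, hK⟩ := hb
    have hfin : (Set.range fun n => truncEnd P p hμ hν n y).Finite := by
      refine ((Set.finite_Iic K).image fun j => truncEnd P p hμ hν j u).subset ?_
      rintro _ ⟨n, rfl⟩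
      exact ⟨k n, hK n, (hk n).symm⟩
    obtain ⟨n, hn⟩ := exists_eq_truncEnd_of_finite_range P p hμ hν hfin
    rw [hn]
    exact h n
  · push Not at hb
    refine Or.inl (eq_of_truncEnd_eq P p hμ hν fun l => ?_)
    by_cases hl : ∃ n ≥ l, l ≤ k n
    · obtain ⟨n, hn, hln⟩ := hl
      exact truncEnd_eq_of_le P p hμ hν (le_min hn hln) (hmin n)
    · -- The finitely many indices below `l` cannot make `k` unbounded.
      push Not at hl
      obtain ⟨n, hn⟩ := hb (l + (Finset.range l).sup k)
      rcases lt_or_ge n l with hnl | hnl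
      · have := Finset.le_sup (f := k) (Finset.mem_range.2 hnl)
        omega
      · have := hl n hnl
        omega

end Truncation

end Cutting

theorem corollaryP (F : Type u ⥤ Type u) [Limits.PreservesFilteredColimits F]
    (hF : Nonempty (F.obj PEmpty.{u + 1}))
    (P : Cutting.Presentation F) (p : P.S 0)
    {μF : Endofunctor.Algebra F} (hμ : Limits.IsInitial μF)
    {νF : Endofunctor.Coalgebra F} (hν : Limits.IsTerminal νF) :
    ∃ _ : PartialOrder νF.V,
      (∀ x y : νF.V, x ≤ y ↔ Cutting.CutLE P p hν x y) ∧
      Function.Injective (Cutting.incl hμ hν) ∧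
      ∀ A : Endofunctor.Coalgebra F,
        ∃ f : A ⟶ νF, (∀ g : A ⟶ νF, g = f) ∧
        ∃ h : ℕ → A.V → μF.a, Cutting.IsApproxHom hμ hν A h ∧
          (∀ h' : ℕ → A.V → μF.a, Cutting.IsApproxHom hμ hν A h' → h' = h) ∧
          Monotone (fun (n : ℕ) (x : A.V) => Cutting.incl hμ hν (h n x)) ∧
          IsLUB (Set.range fun (n : ℕ) (x : A.V) => Cutting.incl hμ hν (h n x))
            (fun x : A.V => f.f x) := by
  have hinj := Cutting.incl_injective P p hμ hν
  have htrunc : ∀ (A : Endofunctor.Coalgebra F) (n : ℕ) (x : A.V),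
      Cutting.incl hμ hν (Cutting.trunc P p μF A n x) =
        Cutting.truncEnd P p hμ hν n ((hν.from A).f x) := fun A n x => by
    rw [Cutting.truncEnd, Cutting.trunc_hom]
  let _ := Cutting.cutOrder P p hμ hν
  have hle : ∀ n y, Cutting.truncEnd P p hμ hν n y ≤ y := fun n y =>
    (Cutting.cutLE_iff P p hμ hν _ _).2 (Or.inr ⟨n, rfl⟩)
  have hA : ∀ A, Cutting.IsApproxHom hμ hν A (Cutting.trunc P p μF A) := fun A =>
    ⟨fun g x => (Cutting.cutLE_iff P p hμ hν _ _).2 (Or.inr ⟨0, rfl⟩), fun _ _ => rfl⟩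
  refine ⟨inferInstance, fun _ _ => Iff.rfl, hinj, fun A => ⟨hν.from A, fun g => hν.hom_ext _ _,
    Cutting.trunc P p μF A, hA A, ?_, ?_, ?_, ?_⟩⟩
  · intro h' hh'
    funext n
    induction n with
    | zero => exact funext fun x => hinj (le_antisymm (hh'.least _ x) ((hA A).least _ x))
    | succ n ih =>
      funext x
      rw [hh'.step, ih]
      rfl
  · intro n k hnk x
    change Cutting.incl hμ hν _ ≤ Cutting.incl hμ hν _
    rw [htrunc, htrunc, ← min_eq_left hnk, ← Cutting.truncEnd_truncEnd]
    exact hle _ _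
  · rintro _ ⟨n, rfl⟩ x
    change Cutting.incl hμ hν _ ≤ _
    rw [htrunc]
    exact hle _ _
  · intro u hu x
    refine Cutting.cutLE_of_truncEnd_cutLE P p hμ hν fun n => ?_
    rw [← htrunc]
    exact hu ⟨n, rfl⟩ x
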